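/- Let $\mathrm{ZFC}^-$ be the theory with axioms Empty Set, Extensionality, Pairing, Unions, Infinity, the Foundation, Separation, Replacement and Collection Schemes, and the Well-Ordering Principle (so Power Set is omitted). For a cardinal $\mu$, the $\mathrm{DC}_\mu$-Scheme says, for all formulae $\varphi,\psi$ and sets $u,w$: if $\psi(y,u)$ holds for some $y$, and for every $\alpha\in\mu$ and every $\alpha$-sequence $s=\langle x_\beta:\beta\in\alpha\rangle$ with $\psi(x_\beta,u)$ for all $\beta\in\alpha$ there is a $z$ with $\psi(z,u)$ and $\varphi(s,z,w)$, then there is a function $f$ with domain $\mu$ such that $\psi(f(\alpha),u)$ and $\varphi(f\restriction\alpha,f(\alpha),w)$ for every $\alpha\in\mu$. Let $\mathrm{ZFC}^-+\mathrm{DC}_{<\mathrm{Ord}}$ be $\mathrm{ZFC}^-$ plus the $\mathrm{DC}_\mu$-Scheme for every cardinal $\mu$. **Lemma.** Suppose that $V\models\mathrm{ZFC}^-+\mathrm{DC}_{<\mathrm{Ord}}$, that $M\subseteq V$ is transitive (every element, in the sense of $V$, of a member of $M$ is in $M$), and that $j:V\to M$ is a non-trivial elementary embedding with critical point $\kappa$,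 that is, $\kappa$ is the least ordinal of $V$ with $j(\kappa)\neq\kappa$. Then for every $\alpha\in\kappa+1$ (that is, for every ordinal $\alpha\le\kappa$), $V_\alpha\in V$; that is, the class $V_\alpha$ of all sets of rank less than $\alpha$ is a set of $V$. -/

import Mathlib

universe u

namespace SetModel

/-- The relation symbols of the language of set theory: one binary symbol. -/
inductive MemRel : ℕ → Type
  | mem : MemRel 2

/-- The first-order language `{∈}` of set theory. -/
def LSet : FirstOrder.Language := ⟨fun _ => Empty, MemRel⟩

section Notions

variable {V : Type u} [LSet.Structure V]

/-- The membership relation of the structure `V`. -/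
def Mem (x y : V) : Prop :=
  FirstOrder.Language.Structure.RelMap (L := LSet) (M := V) MemRel.mem ![x, y]

infix:50 " ∈ₛ " => Mem

/-! All the following notions are interpreted inside `V`: quantifiers range over the elements of
`V`, so that functions, relations and so on are those which are sets of `V`. -/

def IsEmptySet (e : V) : Prop := ∀ x : V, ¬ x ∈ₛ e

/-- `a ⊆ b`. -/
def Sub (a b : V) : Prop := ∀ x : V, x ∈ₛ a → x ∈ₛ b

/-- `p = {x, y}`. -/
def IsUPair (p x y : V) : Prop := ∀ z : V, z ∈ₛ p ↔ z = x ∨ z = y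

/-- `p = ⟨x, y⟩ = {{x}, {x, y}}`. -/
def IsPair (p x y : V) : Prop := ∀ z : V, z ∈ₛ p ↔ IsUPair z x x ∨ IsUPair z x y

/-- `s = x ∪ {x}`. -/
def IsSucc (s x : V) : Prop := ∀ z : V, z ∈ₛ s ↔ z ∈ₛ x ∨ z = x

/-- `⟨x, y⟩ ∈ r`. -/
def PairMem (r x y : V) : Prop := ∃ p : V, IsPair p x y ∧ p ∈ₛ r

/-- `a` is a transitive set. -/
def IsTransSet (a : V) : Prop := ∀ x : V, x ∈ₛ a → Sub x a

/-- `α` is a (von Neumann) ordinal: a transitive set of transitive sets. -/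
def IsOrd (α : V) : Prop := IsTransSet α ∧ ∀ x : V, x ∈ₛ α → IsTransSet x

/-- `f` is a function with domain `d`; its values are given by `PairMem f x y`, that is
`f(x) = y`. -/
def IsFunOn (f d : V) : Prop :=
  (∀ p : V, p ∈ₛ f → ∃ x y : V, x ∈ₛ d ∧ IsPair p x y) ∧
    ∀ x : V, x ∈ₛ d → ∃! y : V, PairMem f x y

/-- `s` is the restriction of `f` to `d`. -/
def IsRestriction (s f d : V) : Prop :=
  ∀ p : V, p ∈ₛ s ↔ p ∈ₛ f ∧ ∃ x y : V, x ∈ₛ d ∧ IsPair p x y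

/-- `f` is a surjection of `a` onto `b`. -/
def IsSurjection (f a b : V) : Prop :=
  IsFunOn f a ∧ ∀ y : V, y ∈ₛ b ↔ ∃ x : V, x ∈ₛ a ∧ PairMem f x y

/-- `f` is a bijection from `a` to `b`. -/
def IsBijection (f a b : V) : Prop :=
  IsSurjection f a b ∧ ∀ x x' y : V, PairMem f x y → PairMem f x' y → x = x'

/-- `μ` is a cardinal: an ordinal not in bijection with any smaller ordinal. -/
def IsCard (μ : V) : Prop :=
  IsOrd μ ∧ ∀ β : V, β ∈ₛ μ → ¬ ∃ f : V, IsBijection f β μ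

/-- The set `r` of ordered pairs strictly well-orders the set `a`. -/
def WellOrders (r a : V) : Prop :=
  (∀ x : V, x ∈ₛ a → ¬ PairMem r x x) ∧
  (∀ x y z : V, x ∈ₛ a → y ∈ₛ a → z ∈ₛ a → PairMem r x y → PairMem r y z → PairMem r x z) ∧
  (∀ x y : V, x ∈ₛ a → y ∈ₛ a → PairMem r x y ∨ x = y ∨ PairMem r y x) ∧
  (∀ b : V, Sub b a → (∃ x : V, x ∈ₛ b) →
    ∃ m : V, m ∈ₛ b ∧ ∀ x : V, x ∈ₛ b → ¬ PairMem r x m)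

/-- `C` is a class of `V`: defined over `V` by a first-order formula with parameters. -/
def IsClass (C : V → Prop) : Prop := (Set.univ : Set V).Definable₁ LSet {x | C x}

/-- `R` is a binary class relation of `V`: defined over `V` by a first-order formula with
parameters. -/
def IsClassRel (R : V → V → Prop) : Prop :=
  (Set.univ : Set V).Definable₂ LSet {p | R p.1 p.2}

/-- The `DC_μ`-Scheme: for a non-empty class `S` and a class relation `R` such that each
`α`-sequence `s` of members of `S`, with `α ∈ μ`, has some `z` in `S` with `R s z`, there is a
function `f` with domain `μ` such that `f(α)` is in `S` and `R (f ↾ α) f(α)` for all `α ∈ μ`. -/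
def DCScheme (μ : V) : Prop :=
  ∀ (S : V → Prop) (R : V → V → Prop), IsClass S → IsClassRel R →
    (∃ y : V, S y) →
    (∀ α s : V, α ∈ₛ μ → IsFunOn s α → (∀ β x : V, β ∈ₛ α → PairMem s β x → S x) →
      ∃ z : V, S z ∧ R s z) →
    ∃ f : V, IsFunOn f μ ∧
      ∀ α : V, α ∈ₛ μ → ∃ x s : V, PairMem f α x ∧ IsRestriction s f α ∧ S x ∧ R s x

/-- The rank of `x` is `ρ`: there is a function `r` on a transitive set containing `x` which
satisfies the rank recursion `r(z) = sup {r(y) + 1 : y ∈ z}` and has `r(x) = ρ`. -/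
def HasRank (x ρ : V) : Prop :=
  ∃ t r : V, IsTransSet t ∧ x ∈ₛ t ∧ IsFunOn r t ∧
    (∀ z σ : V, z ∈ₛ t → PairMem r z σ →
      ∀ γ : V, γ ∈ₛ σ ↔ ∃ y τ : V, y ∈ₛ z ∧ PairMem r y τ ∧ (γ = τ ∨ γ ∈ₛ τ)) ∧
    PairMem r x ρ

/-- The class `V_α` of all sets of rank less than `α`. -/
def InVLevel (α x : V) : Prop := ∃ ρ : V, ρ ∈ₛ α ∧ HasRank x ρ

/-- The class `C` is (the extension of) a set of `V`. -/
def ClassIsSet (C : V → Prop) : Prop := ∃ v : V, ∀ x : V, x ∈ₛ v ↔ C x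

end Notions

/-- `V` is a model of `ZF⁻` (without Power Set, with Collection). -/
structure ModelsZFMinus (V : Type u) [LSet.Structure V] : Prop where
  empty_set : ∃ e : V, IsEmptySet e
  extensionality : ∀ x y : V, (∀ z : V, z ∈ₛ x ↔ z ∈ₛ y) → x = y
  pairing : ∀ x y : V, ∃ p : V, IsUPair p x y
  unions : ∀ a : V, ∃ b : V, ∀ z : V, z ∈ₛ b ↔ ∃ y : V, y ∈ₛ a ∧ z ∈ₛ y
  infinity : ∃ w : V, (∃ e : V, e ∈ₛ w ∧ IsEmptySet e) ∧
    ∀ x : V, x ∈ₛ w → ∃ s : V, s ∈ₛ w ∧ IsSucc s x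
  foundation : ∀ C : V → Prop, IsClass C → (∃ x : V, C x) →
    ∃ x : V, C x ∧ ∀ y : V, y ∈ₛ x → ¬ C y
  separation : ∀ C : V → Prop, IsClass C → ∀ a : V, ∃ b : V, ∀ x : V, x ∈ₛ b ↔ x ∈ₛ a ∧ C x
  replacement : ∀ R : V → V → Prop, IsClassRel R → ∀ a : V,
    (∀ x : V, x ∈ₛ a → ∃! y : V, R x y) →
    ∃ b : V, ∀ y : V, y ∈ₛ b ↔ ∃ x : V, x ∈ₛ a ∧ R x y
  collection : ∀ R : V → V → Prop, IsClassRel R → ∀ a : V,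
    (∀ x : V, x ∈ₛ a → ∃ y : V, R x y) →
    ∃ b : V, ∀ x : V, x ∈ₛ a → ∃ y : V, y ∈ₛ b ∧ R x y

/-- `V` is a model of `ZFC⁻`: `ZF⁻` plus the Well-Ordering Principle. -/
structure ModelsZFCMinus (V : Type u) [LSet.Structure V] : Prop extends ModelsZFMinus V where
  well_ordering : ∀ a : V, ∃ r : V, WellOrders r a

/-- `V` is a model of `ZFC⁻ + DC_{<Ord}`: `ZFC⁻` plus the `DC_μ`-Scheme for every cardinal `μ`. -/
structure ModelsZFCMinusDC (V : Type u) [LSet.Structure V] : Prop extends ModelsZFCMinus V where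
  dc_scheme : ∀ μ : V, IsCard μ → DCScheme μ

section Embeddings

variable {V : Type u} [LSet.Structure V]

/-- `M ⊆ V` is transitive. As `LSet` has no function symbols, every subset of `V` carries a
substructure of `V`, with the restricted membership relation. -/
def IsTransSub (M : LSet.Substructure V) : Prop := ∀ x y : V, x ∈ M → y ∈ₛ x → y ∈ M

/-- `j` is not the identity. -/
def IsNontrivial {M : LSet.Substructure V} (j : FirstOrder.Language.ElementaryEmbedding LSet V M) : Prop :=
  ∃ x : V, (j x : V) ≠ x

/-- `κ` is the critical point of `j`: the least ordinal moved by `j`. -/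
def IsCritPoint {M : LSet.Substructure V} (j : FirstOrder.Language.ElementaryEmbedding LSet V M) (κ : V) : Prop :=
  IsOrd κ ∧ (j κ : V) ≠ κ ∧ ∀ α : V, α ∈ₛ κ → (j α : V) = α

end Embeddings

end SetModel

/-! Without Power Set, a level could be a proper class. For δ < κ one shows that `V_δ` is a set and
is moreover small, i.e. the image of an element of κ; then `V_κ`, a union of set levels, is a set by
Replacement, κ being a limit. Let δ be a least failure. Since κ is a cardinal, `DC_κ` gives an
injection f from κ into the class `V_δ`. As κ < j(κ), the value A = j(f)(κ) exists, and j(A) ≠ A: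
otherwise A would be some f(ξ), giving j(f)(ξ) = j(f)(κ) with ξ < κ (`IsCritPoint.exists_moved`).
But every f(α) is a subset of some `V_β` with β < δ, so A ⊆ j(`V_β`) for some β < δ. As `V_β` is
small and transitive, j fixes its elements and hence A (`IsSmall.apply_eq_of_sub`), a contradiction.
-/

namespace SetModel

open FirstOrder.Language

/-! ### Uniform definability of set-theoretic notions. -/

/-- A predicate of assignments, given in every structure for `LSet`, is uniformly definable if a
single formula without parameters defines it in all structures. -/
class UDef (P : ∀ (W : Type u) [LSet.Structure W], (ℕ → W) → Prop) : Prop where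
  out : ∃ φ : LSet.Formula ℕ, ∀ (W : Type u) [LSet.Structure W] (v : ℕ → W), φ.Realize v ↔ P W v

namespace UDef

variable {P Q : ∀ (W : Type u) [LSet.Structure W], (ℕ → W) → Prop}

instance mem (i k : ℕ) : UDef.{u} (fun _ _ v => v i ∈ₛ v k) :=
  ⟨Relations.formula₂ (L := LSet) MemRel.mem (Term.var i) (Term.var k),
    fun _ _ _ => FirstOrder.Language.Formula.realize_rel₂⟩

instance eq (i k : ℕ) : UDef.{u} (fun _ _ v => v i = v k) :=
  ⟨(Term.var i).equal (Term.var k), fun _ _ _ => FirstOrder.Language.Formula.realize_equal⟩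

instance not [hP : UDef P] : UDef (fun W _ v => ¬ P W v) := by
  obtain ⟨φ, hφ⟩ := hP
  exact ⟨φ.not, fun W _ v => not_congr (hφ W v)⟩

instance and [hP : UDef P] [hQ : UDef Q] : UDef (fun W _ v => P W v ∧ Q W v) := by
  obtain ⟨φ, hφ⟩ := hP
  obtain ⟨ψ, hψ⟩ := hQ
  exact ⟨φ ⊓ ψ, fun W _ v => Formula.realize_inf.trans (and_congr (hφ W v) (hψ W v))⟩

instance imp [hP : UDef P] [hQ : UDef Q] : UDef (fun W _ v => P W v → Q W v) := by
  obtain ⟨φ, hφ⟩ := hP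
  obtain ⟨ψ, hψ⟩ := hQ
  exact ⟨φ.imp ψ, fun W _ v => Formula.realize_imp.trans (imp_congr (hφ W v) (hψ W v))⟩

instance or [hP : UDef P] [hQ : UDef Q] : UDef (fun W _ v => P W v ∨ Q W v) := by
  obtain ⟨φ, hφ⟩ := hP
  obtain ⟨ψ, hψ⟩ := hQ
  exact ⟨φ ⊔ ψ, fun W _ v => Formula.realize_sup.trans (or_congr (hφ W v) (hψ W v))⟩

instance iff [hP : UDef P] [hQ : UDef Q] : UDef (fun W _ v => P W v ↔ Q W v) := by
  obtain ⟨φ, hφ⟩ := hP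
  obtain ⟨ψ, hψ⟩ := hQ
  exact ⟨φ.iff ψ, fun W _ v => Formula.realize_iff.trans (iff_congr (hφ W v) (hψ W v))⟩

/-- De Bruijn indexing: variable 0 is the quantified one, and variable `n + 1` becomes `n`. -/
instance ex {P : ∀ (W : Type u) [LSet.Structure W], (ℕ → W) → W → Prop}
    [hP : UDef (fun W _ v => P W (fun n => v (n + 1)) (v 0))] :
    UDef (fun W _ v => ∃ x : W, P W v x) := by
  obtain ⟨φ, hφ⟩ := hP
  refine ⟨Formula.iExs Unit (BoundedFormula.subst φ fun n =>
    Term.var (Nat.casesOn n (Sum.inr ()) Sum.inl : ℕ ⊕ Unit)), fun W _ v => ?_⟩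
  rw [Formula.realize_iExs]
  simp only [Formula.Realize, BoundedFormula.realize_subst]
  simp only [← Formula.Realize.eq_1, hφ]
  exact ⟨fun ⟨i, h⟩ => ⟨i (), h⟩, fun ⟨x, h⟩ => ⟨fun _ => x, h⟩⟩

instance all {P : ∀ (W : Type u) [LSet.Structure W], (ℕ → W) → W → Prop}
    [hP : UDef (fun W _ v => P W (fun n => v (n + 1)) (v 0))] :
    UDef (fun W _ v => ∀ x : W, P W v x) := by
  have : UDef (fun W _ v => ¬ ∃ x : W, ¬ P W v x) := inferInstance
  simpa only [not_exists, not_not] using this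

instance exUnique {P : ∀ (W : Type u) [LSet.Structure W], (ℕ → W) → W → Prop}
    [hP : UDef (fun W _ v => ∃ x : W, P W v x ∧ ∀ y : W, P W v y → y = x)] :
    UDef (fun W _ v => ∃! x : W, P W v x) := hP

instance sub (i k : ℕ) : UDef.{u} (fun _ _ v => Sub (v i) (v k)) := by
  unfold Sub; infer_instance
instance isUPair (i k l : ℕ) : UDef.{u} (fun _ _ v => IsUPair (v i) (v k) (v l)) := by
  unfold IsUPair; infer_instance
instance isPair (i k l : ℕ) : UDef.{u} (fun _ _ v => IsPair (v i) (v k) (v l)) := by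
  unfold IsPair; infer_instance
instance isSucc (i k : ℕ) : UDef.{u} (fun _ _ v => IsSucc (v i) (v k)) := by
  unfold IsSucc; infer_instance
instance pairMem (i k l : ℕ) : UDef.{u} (fun _ _ v => PairMem (v i) (v k) (v l)) := by
  unfold PairMem; infer_instance
instance isTransSet (i : ℕ) : UDef.{u} (fun _ _ v => IsTransSet (v i)) := by
  unfold IsTransSet; infer_instance
instance isOrd (i : ℕ) : UDef.{u} (fun _ _ v => IsOrd (v i)) := by
  unfold IsOrd; infer_instance
instance isFunOn (i k : ℕ) : UDef.{u} (fun _ _ v => IsFunOn (v i) (v k)) := by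
  unfold IsFunOn; infer_instance
instance hasRank (i k : ℕ) : UDef.{u} (fun _ _ v => HasRank (v i) (v k)) := by
  unfold HasRank; infer_instance
instance inVLevel (i k : ℕ) : UDef.{u} (fun _ _ v => InVLevel (v i) (v k)) := by
  unfold InVLevel; infer_instance

end UDef

/-- The assignment with the five values `a`, `b`, `c`, `d`, `e`. -/
def assign {W : Type u} (a b c d e : W) : ℕ → W
  | 0 => a
  | 1 => b
  | 2 => c
  | 3 => d
  | _ => e

/-! ### Definable classes and elementarity. -/

section

variable {V : Type u} [LSet.Structure V]

theorem UDef.definable {P : ∀ (W : Type u) [LSet.Structure W], (ℕ → W) → Prop} (hP : UDef P)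
    {n : ℕ} (w : ℕ → Fin n ⊕ V) :
    (Set.univ : Set V).Definable LSet {x : Fin n → V | P V (fun i => Sum.elim x id (w i))} := by
  obtain ⟨φ, hφ⟩ := hP
  refine ⟨BoundedFormula.subst ((lhomWithConstants LSet (Set.univ : Set V)).onFormula φ)
    (fun i => Sum.elim Term.var
      (fun c => (LSet.con (⟨c, trivial⟩ : (Set.univ : Set V))).term) (w i)), ?_⟩
  ext x
  refine (hφ V _).symm.trans ?_
  refine Iff.trans ?_ BoundedFormula.realize_subst.symm
  refine Iff.trans ?_ (LHom.realize_onFormula _ φ).symm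
  refine iff_of_eq (congrArg _ (funext fun i => ?_))
  cases w i <;> simp

theorem isClass_of_uDef (P : ∀ (W : Type u) [LSet.Structure W], W → W → W → W → W → Prop)
    [hP : UDef (fun W _ v => P W (v 0) (v 1) (v 2) (v 3) (v 4))] (b c d e : V) :
    IsClass (fun x => P V x b c d e) :=
  hP.definable (assign (Sum.inl (0 : Fin 1)) (Sum.inr b) (Sum.inr c) (Sum.inr d) (Sum.inr e))

theorem isClassRel_of_uDef (P : ∀ (W : Type u) [LSet.Structure W], W → W → W → Prop)
    [hP : UDef (fun W _ v => P W (v 0) (v 1) (v 2))] (c : V) :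
    IsClassRel (fun x y => P V x y c) :=
  hP.definable (assign (Sum.inl (0 : Fin 2)) (Sum.inl 1) (Sum.inr c) (Sum.inr c) (Sum.inr c))

theorem transfer {M : LSet.Substructure V} (j : FirstOrder.Language.ElementaryEmbedding LSet V M)
    (P : ∀ (W : Type u) [LSet.Structure W], W → W → W → W → Prop)
    [hP : UDef (fun W _ v => P W (v 0) (v 1) (v 2) (v 3))] (a b c d : V) :
    P V a b c d ↔ P M (j a) (j b) (j c) (j d) := by
  obtain ⟨φ, hφ⟩ := hP
  have h := j.map_formula φ (assign a b c d d)
  rw [hφ, hφ] at h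
  exact h.symm

theorem mem_coe {M : LSet.Substructure V} (a b : M) : a ∈ₛ b ↔ (a : V) ∈ₛ (b : V) := by
  unfold Mem
  refine iff_of_eq (congrArg (Structure.RelMap (L := LSet) (M := V) MemRel.mem) (funext fun i => ?_))
  fin_cases i <;> rfl

end

/-! ### Ordinals, ranks, functions and dependent choice in V. -/

section

variable {V : Type u} [LSet.Structure V]

theorem ModelsZFMinus.mem_irrefl (hV : ModelsZFMinus V) (a : V) : ¬ a ∈ₛ a := by
  obtain ⟨x, rfl, hx⟩ := hV.foundation _
    (isClass_of_uDef (fun _ _ x b _ _ _ => x = b) a a a a) ⟨a, rfl⟩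
  exact fun h => hx _ h rfl

theorem IsOrd.of_mem {α β : V} (hα : IsOrd α) (h : β ∈ₛ α) : IsOrd β :=
  ⟨hα.2 β h, fun x hx => hα.2 x (hα.1 β h x hx)⟩

/-- The ordinals are linearly ordered by membership. -/
theorem ModelsZFMinus.ord_trichotomy (hV : ModelsZFMinus V) {α β : V} (hα : IsOrd α)
    (hβ : IsOrd β) : α ∈ₛ β ∨ α = β ∨ β ∈ₛ α := by
  by_contra hn
  obtain ⟨a, ⟨ha, b', hb', hab'⟩, hmin⟩ := hV.foundation _
    (isClass_of_uDef (fun _ _ a _ _ _ _ => IsOrd a ∧ ∃ b, IsOrd b ∧ ¬ (a ∈ₛ b ∨ a = b ∨ b ∈ₛ a))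
      α α α α) ⟨α, hα, β, hβ, hn⟩
  obtain ⟨b, ⟨hb, hab⟩, hmin'⟩ := hV.foundation _
    (isClass_of_uDef (fun _ _ b a _ _ _ => IsOrd b ∧ ¬ (a ∈ₛ b ∨ a = b ∨ b ∈ₛ a)) a a a a)
    ⟨b', hb', hab'⟩
  -- With `a` minimal among ordinals incomparable to some ordinal, and `b` minimal among those
  -- incomparable to `a`, both have the same elements.
  refine hab (Or.inr (Or.inl (hV.extensionality _ _ fun z => ⟨fun hz => ?_, fun hz => ?_⟩)))
  · by_contra hzb
    refine hmin z hz ⟨ha.of_mem hz, b, hb, ?_⟩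
    rintro (h | rfl | h)
    · exact hzb h
    · exact hab (Or.inr (Or.inr hz))
    · exact hab (Or.inr (Or.inr (ha.1 z hz b h)))
  · by_contra hza
    refine hmin' z hz ⟨hb.of_mem hz, ?_⟩
    rintro (h | rfl | h)
    · exact hab (Or.inl (hb.1 z hz a h))
    · exact hab (Or.inl hz)
    · exact hza h

theorem ModelsZFMinus.exists_isSucc (hV : ModelsZFMinus V) (a : V) : ∃ s : V, IsSucc s a := by
  obtain ⟨p, hp⟩ := hV.pairing a a
  obtain ⟨q, hq⟩ := hV.pairing a p
  obtain ⟨s, hs⟩ := hV.unions q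
  refine ⟨s, fun z => (hs z).trans ⟨?_, ?_⟩⟩
  · rintro ⟨y, hy, hz⟩
    rcases (hq y).1 hy with rfl | rfl
    · exact Or.inl hz
    · exact Or.inr (by simpa using (hp z).1 hz)
  · rintro (h | rfl)
    · exact ⟨a, (hq a).2 (Or.inl rfl), h⟩
    · exact ⟨p, (hq p).2 (Or.inr rfl), (hp z).2 (Or.inl rfl)⟩

theorem IsOrd.isSucc {s β : V} (hβ : IsOrd β) (h : IsSucc s β) : IsOrd s := by
  have key : ∀ x, x ∈ₛ s → IsTransSet x ∧ Sub x s := fun x hx => by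
    rcases (h x).1 hx with hx | rfl
    · exact ⟨hβ.2 x hx, fun z hz => (h z).2 (Or.inl (hβ.1 x hx z hz))⟩
    · exact ⟨hβ.1, fun z hz => (h z).2 (Or.inl hz)⟩
  exact ⟨fun x hx => (key x hx).2, fun x hx => (key x hx).1⟩

/-- Membership of the rank in the rank of a set containing it. -/
theorem HasRank.exists_mem {x ρ z : V} (h : HasRank x ρ) (hz : z ∈ₛ x) :
    ∃ τ, τ ∈ₛ ρ ∧ HasRank z τ := by
  obtain ⟨t, r, ht, hxt, hr, hrec, hxρ⟩ := h
  have hzt := ht x hxt z hz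
  obtain ⟨τ, hτ, -⟩ := hr.2 z hzt
  exact ⟨τ, (hrec x ρ hxt hxρ τ).2 ⟨z, τ, hz, hτ, Or.inl rfl⟩, t, r, ht, hzt, hr, hrec, hτ⟩

theorem InVLevel.of_mem {α x z : V} (hα : IsOrd α) (h : InVLevel α x) (hz : z ∈ₛ x) :
    InVLevel α z := by
  obtain ⟨ρ, hρ, hx⟩ := h
  obtain ⟨τ, hτ, hzτ⟩ := hx.exists_mem hz
  exact ⟨τ, hα.1 ρ hρ τ hτ, hzτ⟩

/-- `v` is the set `V_α`. -/
def IsVLevel (α v : V) : Prop := ∀ x : V, x ∈ₛ v ↔ InVLevel α x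

instance UDef.isVLevel (i k : ℕ) : UDef.{u} (fun _ _ v => IsVLevel (v i) (v k)) := by
  unfold IsVLevel; infer_instance

/-- Each element of `t` is the unique value of the set `b` of pairs at an element of `l`. -/
def Covers (b l t : V) : Prop :=
  ∀ z : V, z ∈ₛ t → ∃ η : V, η ∈ₛ l ∧ PairMem b η z ∧ ∀ y : V, PairMem b η y → y = z

instance UDef.covers (i k l : ℕ) : UDef.{u} (fun _ _ v => Covers (v i) (v k) (v l)) := by
  unfold Covers; infer_instance

/-- `t` is the image of an element of `κ`. -/
def IsSmall (κ t : V) : Prop := ∃ l : V, l ∈ₛ κ ∧ ∃ b : V, Covers b l t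

instance UDef.isSmall (i k : ℕ) : UDef.{u} (fun _ _ v => IsSmall (v i) (v k)) := by
  unfold IsSmall; infer_instance

/-- The limit hypothesis is what puts a set of rank ρ < κ into a level `V_(ρ+1)` with ρ + 1 < κ. -/
theorem ModelsZFMinus.exists_isVLevel_of_cofinal (hV : ModelsZFMinus V) {κ : V} (hκ : IsOrd κ)
    (hlim : ∀ β : V, β ∈ₛ κ → ∃ s : V, s ∈ₛ κ ∧ IsSucc s β)
    (h : ∀ β : V, β ∈ₛ κ → ∃ v : V, IsVLevel β v) : ∃ v : V, IsVLevel κ v := by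
  obtain ⟨b, hb⟩ := hV.replacement _ (isClassRel_of_uDef (fun _ _ β v _ => IsVLevel β v) κ) κ
    fun β hβ => by
      obtain ⟨v, hv⟩ := h β hβ
      exact ⟨v, hv, fun w hw => hV.extensionality _ _ fun x => (hw x).trans (hv x).symm⟩
  obtain ⟨v, hv⟩ := hV.unions b
  refine ⟨v, fun x => (hv x).trans ⟨?_, ?_⟩⟩
  · rintro ⟨y, hy, hx⟩
    obtain ⟨β, hβ, hβy⟩ := (hb y).1 hy
    obtain ⟨ρ, hρ, hxρ⟩ := (hβy x).1 hx
    exact ⟨ρ, hκ.1 β hβ ρ hρ, hxρ⟩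
  · rintro ⟨ρ, hρ, hxρ⟩
    obtain ⟨s, hs, hsρ⟩ := hlim ρ hρ
    obtain ⟨w, hw⟩ := h s hs
    exact ⟨w, (hb w).2 ⟨s, hs, hw⟩, (hw x).2 ⟨ρ, (hsρ ρ).2 (Or.inr rfl), hxρ⟩⟩

theorem IsPair.inj (hV : ModelsZFMinus V) {p x y x' y' : V} (h : IsPair p x y)
    (h' : IsPair p x' y') : x = x' ∧ y = y' := by
  obtain ⟨u, hu⟩ := hV.pairing x x
  have hx : x' = x := by
    rcases (h' u).1 ((h u).2 (Or.inl hu)) with h1 | h1 <;>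
      simpa using (hu x').1 ((h1 x').2 (Or.inl rfl))
  subst hx
  have key : ∀ a b, IsPair p x' a → IsPair p x' b → a = x' ∨ a = b := fun a b ha hb => by
    obtain ⟨q, hq⟩ := hV.pairing x' a
    have hqa := (hq a).2 (Or.inr rfl)
    rcases (hb q).1 ((ha q).2 (Or.inr hq)) with h1 | h1
    · exact Or.inl (by simpa using (h1 a).1 hqa)
    · exact (h1 a).1 hqa
  refine ⟨rfl, ?_⟩
  rcases key y y' h h' with h1 | h1
  · rcases key y' y h' h with h2 | h2
    · rw [h1, h2]
    · exact h2.symm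
  · exact h1

theorem IsFunOn.mem_of_pairMem (hV : ModelsZFMinus V) {f d x y : V} (hf : IsFunOn f d)
    (h : PairMem f x y) : x ∈ₛ d := by
  obtain ⟨p, hp, hpf⟩ := h
  obtain ⟨x', y', hx', hp'⟩ := hf.1 p hpf
  exact (hp.inj hV hp').1 ▸ hx'

theorem IsRestriction.pairMem {s f d η x : V} (h : IsRestriction s f d) (hη : η ∈ₛ d)
    (hx : PairMem f η x) : PairMem s η x := by
  obtain ⟨p, hp, hpf⟩ := hx
  exact ⟨p, hp, (h p).2 ⟨hpf, η, x, hη, hp⟩⟩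

/-- A class which is not the range of a function on an element of the cardinal `κ` admits an
injective sequence of length `κ`. -/
theorem ModelsZFCMinusDC.exists_injective (hV : ModelsZFCMinusDC V) {κ : V} (hκ : IsCard κ)
    {S : V → Prop} (hS : IsClass S) (hne : ∃ y, S y)
    (h : ∀ α s : V, α ∈ₛ κ → IsFunOn s α → (∀ β x : V, β ∈ₛ α → PairMem s β x → S x) →
      ∃ z, S z ∧ ¬ ∃ β, PairMem s β z) :
    ∃ f : V, IsFunOn f κ ∧ (∀ α x, α ∈ₛ κ → PairMem f α x → S x) ∧
      ∀ α β x, α ∈ₛ κ → β ∈ₛ κ → PairMem f α x → PairMem f β x → α = β := by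
  -- The relation asks that each new term avoid all earlier values.
  obtain ⟨f, hf, hval⟩ := hV.dc_scheme κ hκ S (fun s z => ¬ ∃ β, PairMem s β z) hS
    (isClassRel_of_uDef (fun _ _ s z _ => ¬ ∃ β, PairMem s β z) κ) hne h
  have hnot : ∀ α β x, α ∈ₛ β → β ∈ₛ κ → PairMem f α x → ¬ PairMem f β x :=
    fun α β x hα hβ hx hx' => by
      obtain ⟨y, s, hy, hs, -, hns⟩ := hval β hβ
      obtain rfl := (hf.2 β hβ).unique hx' hy
      exact hns ⟨α, hs.pairMem hα hx⟩
  refine ⟨f, hf, fun α x hα hx => ?_, fun α β x hα hβ hx hx' => ?_⟩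
  · obtain ⟨y, s, hy, hs, hSy, -⟩ := hval α hα
    exact (hf.2 α hα).unique hy hx ▸ hSy
  · rcases hV.ord_trichotomy (hκ.1.of_mem hα) (hκ.1.of_mem hβ) with hl | he | hl
    · exact absurd hx' (hnot α β x hl hβ hx)
    · exact he
    · exact absurd hx (hnot β α x hl hα hx')

theorem ModelsZFMinus.exists_range (hV : ModelsZFMinus V) {s α : V} (hs : IsFunOn s α) :
    ∃ v : V, (∀ x, x ∈ₛ v ↔ ∃ β, β ∈ₛ α ∧ PairMem s β x) ∧ Covers s α v := by
  obtain ⟨v, hv⟩ := hV.replacement _ (isClassRel_of_uDef (fun _ _ β x s => PairMem s β x) s) α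
    hs.2
  refine ⟨v, hv, fun z hz => ?_⟩
  obtain ⟨β, hβ, hz⟩ := (hv z).1 hz
  exact ⟨β, hβ, hz, fun y hy => (hs.2 β hβ).unique hy hz⟩

end

/-! ### Absoluteness for M and the critical point. -/

section

variable {V : Type u} [LSet.Structure V] {M : LSet.Substructure V}
  {j : FirstOrder.Language.ElementaryEmbedding LSet V M} {κ : V}

theorem mem_iff (j : FirstOrder.Language.ElementaryEmbedding LSet V M) (a b : V) :
    a ∈ₛ b ↔ (j a : V) ∈ₛ (j b : V) :=
  (transfer j (fun _ _ a b _ _ => a ∈ₛ b) a b a a).trans (mem_coe _ _)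

theorem IsTransSub.isUPair (hM : IsTransSub M) {p x y : M} :
    IsUPair p x y ↔ IsUPair (p : V) x y := by
  constructor
  · refine fun h z => ⟨fun hz => ?_, ?_⟩
    · have := (h ⟨z, hM _ _ p.2 hz⟩).1 ((mem_coe _ _).2 hz)
      simpa only [Subtype.ext_iff] using this
    · rintro (rfl | rfl)
      · exact (mem_coe _ _).1 ((h x).2 (Or.inl rfl))
      · exact (mem_coe _ _).1 ((h y).2 (Or.inr rfl))
  · exact fun h z => (mem_coe _ _).trans ((h z).trans (by simp only [Subtype.ext_iff]))

theorem exists_isUPair (hV : ModelsZFMinus V)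
    (j : FirstOrder.Language.ElementaryEmbedding LSet V M) (x y : M) : ∃ p : M, IsUPair p x y := by
  obtain ⟨e, -⟩ := hV.empty_set
  exact (transfer j (fun W _ _ _ _ _ => ∀ x y : W, ∃ p, IsUPair p x y) e e e e).1 hV.pairing x y

/-- By elementarity M satisfies Pairing, so the unordered pairs of elements of M, as computed in V,
lie in M. -/
theorem IsTransSub.isPair (hM : IsTransSub M) (hV : ModelsZFMinus V)
    (j : FirstOrder.Language.ElementaryEmbedding LSet V M) {p x y : M} :
    IsPair p x y ↔ IsPair (p : V) x y := by
  have key : ∀ (z : V) (x y : M), IsUPair z x y → z ∈ M := fun z x y hz => by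
    obtain ⟨q, hq⟩ := exists_isUPair hV j x y
    rw [hM.isUPair] at hq
    rw [hV.extensionality z q fun w => (hz w).trans (hq w).symm]
    exact q.2
  constructor
  · intro h z
    by_cases hz : z ∈ M
    · have := h ⟨z, hz⟩
      rwa [hM.isUPair, hM.isUPair, mem_coe] at this
    · refine ⟨fun h' => absurd (hM _ _ p.2 h') hz, ?_⟩
      rintro (h' | h')
      · exact absurd (key _ _ _ h') hz
      · exact absurd (key _ _ _ h') hz
  · intro h z
    rw [hM.isUPair, hM.isUPair, mem_coe]
    exact h z

theorem IsTransSub.pairMem (hM : IsTransSub M) (hV : ModelsZFMinus V)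
    (j : FirstOrder.Language.ElementaryEmbedding LSet V M) {r x y : M} :
    PairMem r x y ↔ PairMem (r : V) x y := by
  constructor
  · rintro ⟨p, hp, hpr⟩
    exact ⟨p, (hM.isPair hV j).1 hp, (mem_coe _ _).1 hpr⟩
  · rintro ⟨p, hp, hpr⟩
    exact ⟨⟨p, hM _ _ r.2 hpr⟩, (hM.isPair hV j).2 hp, (mem_coe _ _).2 hpr⟩

theorem IsTransSub.mem_of_pairMem (hM : IsTransSub M) (hV : ModelsZFMinus V) {r : M} {x y : V}
    (h : PairMem (r : V) x y) : y ∈ M := by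
  obtain ⟨p, hp, hpr⟩ := h
  obtain ⟨q, hq⟩ := hV.pairing x y
  exact hM _ _ (hM _ _ (hM _ _ r.2 hpr) ((hp q).2 (Or.inr hq))) ((hq y).2 (Or.inr rfl))

theorem IsTransSub.isOrd_apply (hM : IsTransSub M)
    (j : FirstOrder.Language.ElementaryEmbedding LSet V M) {α : V} (hα : IsOrd α) :
    IsOrd (j α : V) := by
  have key : ∀ a : M, IsTransSet a → IsTransSet (a : V) := fun a ha x hx z hz =>
    (mem_coe ⟨z, hM _ _ (hM _ _ a.2 hx) hz⟩ a).1
      (ha ⟨x, hM _ _ a.2 hx⟩ ((mem_coe _ _).2 hx) _ ((mem_coe _ _).2 hz))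
  have h := (transfer j (fun _ _ a _ _ _ => IsOrd a) α α α α).1 hα
  exact ⟨key _ h.1, fun x hx =>
    key ⟨x, hM _ _ (j α).2 hx⟩ (h.2 ⟨x, hM _ _ (j α).2 hx⟩ ((mem_coe _ _).2 hx))⟩

theorem IsCritPoint.mem_apply (hV : ModelsZFMinus V) (hM : IsTransSub M)
    (hκ : IsCritPoint j κ) : κ ∈ₛ (j κ : V) := by
  rcases hV.ord_trichotomy hκ.1 (hM.isOrd_apply j hκ.1) with h | h | h
  · exact h
  · exact absurd h.symm hκ.2.1
  -- If j(κ) < κ, then j fixes j(κ), while elementarity gives j(j(κ)) ∈ j(κ).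
  · have h' := (mem_iff j _ _).1 h
    rw [hκ.2.2 _ h] at h'
    exact absurd h' (hV.mem_irrefl _)

/-- The successor of a fixed ordinal is fixed, so it cannot be κ. -/
theorem IsCritPoint.exists_isSucc (hV : ModelsZFMinus V) (hM : IsTransSub M)
    (hκ : IsCritPoint j κ) {β : V} (hβ : β ∈ₛ κ) : ∃ s : V, s ∈ₛ κ ∧ IsSucc s β := by
  obtain ⟨s, hs⟩ := hV.exists_isSucc β
  refine ⟨s, ?_, hs⟩
  have hjs : (j s : V) = s := hV.extensionality _ _ fun z => by
    rw [hs z]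
    have h := (transfer j (fun _ _ s b _ _ => IsSucc s b) s β β β).1 hs
    constructor
    · intro hz
      have := (h ⟨z, hM _ _ (j s).2 hz⟩).1 ((mem_coe _ _).2 hz)
      rwa [mem_coe, Subtype.ext_iff, hκ.2.2 β hβ] at this
    · rintro (hz | rfl)
      · have := (mem_coe _ _).1 ((h (j z)).2 (Or.inl ((mem_coe _ _).2 ((mem_iff j _ _).1 hz))))
        rwa [hκ.2.2 z (hκ.1.1 β hβ z hz)] at this
      · have := (mem_coe _ _).1 ((h (j z)).2 (Or.inr rfl))
        rwa [hκ.2.2 z hβ] at this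
  rcases hV.ord_trichotomy ((hκ.1.of_mem hβ).isSucc hs) hκ.1 with h | rfl | h
  · exact h
  · exact absurd hjs hκ.2.1
  · rcases (hs κ).1 h with h | rfl
    · exact absurd ((hκ.1.1 β hβ) κ h) (hV.mem_irrefl _)
    · exact absurd hβ (hV.mem_irrefl _)

/-- The image of a small set consists of the images of its elements. -/
theorem IsSmall.exists_of_mem_apply (hM : IsTransSub M) (hκ : IsCritPoint j κ) {t z : V}
    (ht : IsSmall κ t) (hz : z ∈ₛ (j t : V)) : ∃ y, y ∈ₛ t ∧ (j y : V) = z := by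
  obtain ⟨l, hl, b, hb⟩ := ht
  -- In M, j(b) covers j(t) from j(l) = l, so z is the value of j(b) at some η = j(η); this forces z
  -- = j(b(η)).
  obtain ⟨⟨η, hηM⟩, hη, hbz, huniq⟩ := (transfer j (fun _ _ b l t _ => Covers b l t) b l t t).1 hb
    ⟨z, hM _ _ (j t).2 hz⟩ ((mem_coe _ _).2 hz)
  have hηl : η ∈ₛ l := by
    have := (mem_coe _ _).1 hη
    rwa [hκ.2.2 l hl] at this
  have hjη : j η = ⟨η, hηM⟩ := Subtype.ext (hκ.2.2 η (hκ.1.1 l hl η hηl))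
  rw [← hjη] at hbz huniq
  obtain ⟨y, hy, hby⟩ := (transfer j (fun _ _ b η t _ => ∃ z, z ∈ₛ t ∧ PairMem b η z) b η t t).2
    ⟨_, (mem_coe _ _).2 hz, hbz⟩
  exact ⟨y, hy, congrArg Subtype.val
    (huniq _ ((transfer j (fun _ _ b η y _ => PairMem b η y) b η y y).1 hby))⟩

/-- The embedding fixes the elements of small transitive sets. -/
theorem IsSmall.apply_eq (hV : ModelsZFMinus V) (hM : IsTransSub M) (hκ : IsCritPoint j κ)
    {t : V} (htr : IsTransSet t) (ht : IsSmall κ t) {x : V} (hx : x ∈ₛ t) : (j x : V) = x := by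
  obtain ⟨l, hl, b, hb⟩ := id ht
  have hfix : ∀ η, η ∈ₛ l → (j η : V) = η := fun η hη => hκ.2.2 η (hκ.1.1 l hl η hη)
  -- Foundation needs a definable class, and j need not be one. On t, being moved by j is expressed
  -- with the single parameter j(b): x is fixed iff some η in l has x as its b-value and as a
  -- j(b)-value.
  let C : V → Prop := fun x => x ∈ₛ t ∧ ¬ ∃ η, η ∈ₛ l ∧
    (PairMem b η x ∧ ∀ y, PairMem b η y → y = x) ∧ PairMem (j b : V) η x
  have hC : IsClass C := isClass_of_uDef (fun _ _ x t l b b' => x ∈ₛ t ∧ ¬ ∃ η, η ∈ₛ l ∧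
    (PairMem b η x ∧ ∀ y, PairMem b η y → y = x) ∧ PairMem b' η x) t l b (j b : V)
  have key : ∀ x, x ∈ₛ t → (C x ↔ (j x : V) ≠ x) := by
    intro x hx
    rw [← not_iff_not, not_not]
    simp only [C, hx, true_and, not_not]
    constructor
    · rintro ⟨η, hη, ⟨hbη, hu⟩, hjb⟩
      have hxM := hM.mem_of_pairMem hV hjb
      have h := (transfer j (fun _ _ b η x _ => ∀ y, PairMem b η y → y = x) b η x x).1 hu
        ⟨x, hxM⟩ ((hM.pairMem hV j).2 (by rwa [hfix η hη]))
      exact (congrArg Subtype.val h).symm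
    · intro hjx
      obtain ⟨η, hη, hbη, hu⟩ := hb x hx
      refine ⟨η, hη, ⟨hbη, hu⟩, ?_⟩
      have := (hM.pairMem hV j).1 ((transfer j (fun _ _ b η x _ => PairMem b η x) b η x x).1 hbη)
      rwa [hjx, hfix η hη] at this
  by_contra hne
  obtain ⟨y, hy, hmin⟩ := hV.foundation C hC ⟨x, (key x hx).2 hne⟩
  refine (key y hy.1).1 hy (hV.extensionality _ _ fun z => ⟨fun hz => ?_, fun hz => ?_⟩)
  · obtain ⟨w, hw, rfl⟩ := ht.exists_of_mem_apply hM hκ (z := z)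
      ((mem_coe ⟨z, hM _ _ (j y).2 hz⟩ _).1
        ((transfer j (fun _ _ y t _ _ => Sub y t) y t t t).1 (htr y hy.1) _ ((mem_coe _ _).2 hz)))
    have hwy := (mem_iff j _ _).2 hz
    rwa [not_not.1 (mt (key w hw).2 (hmin w hwy))]
  · have h := (mem_iff j _ _).1 hz
    rwa [not_not.1 (mt (key z (htr y hy.1 z hz)).2 (hmin z hz))] at h

/-- A bijection from a smaller ordinal would make κ small; then κ ∈ j(κ) would be j(y) = y for some
y ∈ κ. -/
theorem IsCritPoint.isCard (hV : ModelsZFMinus V) (hM : IsTransSub M) (hκ : IsCritPoint j κ) :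
    IsCard κ := by
  refine ⟨hκ.1, fun β hβ ⟨g, ⟨hg, hsurj⟩, _⟩ => ?_⟩
  have hsmall : IsSmall κ κ := ⟨β, hβ, g, fun z hz => by
    obtain ⟨η, hη, h⟩ := (hsurj z).1 hz
    exact ⟨η, hη, h, fun y hy => (hg.2 η hη).unique hy h⟩⟩
  obtain ⟨y, hy, h⟩ := hsmall.exists_of_mem_apply hM hκ (hκ.mem_apply hV hM)
  rw [hκ.2.2 y hy] at h
  exact hV.mem_irrefl _ (h ▸ hy)

/-- The image under `j` of an injective `κ`-sequence has a value at `κ` which `j` moves. -/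
theorem IsCritPoint.exists_moved (hV : ModelsZFMinus V) (hM : IsTransSub M)
    (hκ : IsCritPoint j κ) {f : V} (hf : IsFunOn f κ)
    (hinj : ∀ α β x, α ∈ₛ κ → β ∈ₛ κ → PairMem f α x → PairMem f β x → α = β) :
    ∃ k A : M, (k : V) = κ ∧ k ∈ₛ j κ ∧ PairMem (j f) k A ∧ j A ≠ A := by
  have hκj := hκ.mem_apply hV hM
  have hκM : κ ∈ M := hM _ _ (j κ).2 hκj
  have hk : (⟨κ, hκM⟩ : M) ∈ₛ j κ := (mem_coe _ _).2 hκj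
  obtain ⟨A, hA, -⟩ := ((transfer j (fun _ _ f κ _ _ => IsFunOn f κ) f κ κ κ).1 hf).2 _ hk
  refine ⟨_, A, rfl, hk, hA, fun hjA => ?_⟩
  obtain ⟨ξ, hξ, hξA⟩ := (transfer j (fun _ _ f κ x _ => ∃ α, α ∈ₛ κ ∧ PairMem f α x) f κ A κ).2
    ⟨_, hk, hjA.symm ▸ hA⟩
  have h := (transfer j (fun W _ f κ _ _ => ∀ α β x : W, α ∈ₛ κ → β ∈ₛ κ → PairMem f α x →
    PairMem f β x → α = β) f κ κ κ).1 hinj (j ξ) _ _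
    ((mem_coe _ _).2 ((mem_iff j _ _).1 hξ)) hk
    (((transfer j (fun _ _ f α x _ => PairMem f α x) f ξ A A).1 hξA)) (hjA.symm ▸ hA)
  have h' := congrArg Subtype.val h
  rw [hκ.2.2 ξ hξ] at h'
  exact hV.mem_irrefl κ (by simpa only [h'] using hξ)

/-- A subset of a small transitive set is fixed by `j`, also when it is only known to be
contained in the image of that set. -/
theorem IsSmall.apply_eq_of_sub (hV : ModelsZFMinus V) (hM : IsTransSub M)
    (hκ : IsCritPoint j κ) {t : V} (htr : IsTransSet t) (ht : IsSmall κ t) {A : M}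
    (hA : Sub A (j t)) : j A = A := by
  have hsub : ∀ z, z ∈ₛ (A : V) → z ∈ₛ t := fun z hz => by
    obtain ⟨y, hy, h⟩ := ht.exists_of_mem_apply hM hκ
      ((mem_coe _ _).1 (hA ⟨z, hM _ _ A.2 hz⟩ ((mem_coe _ _).2 hz)))
    rw [ht.apply_eq hV hM hκ htr hy] at h
    subst h
    exact hy
  refine Subtype.ext (hV.extensionality _ _ fun z => ⟨fun hz => ?_, fun hz => ?_⟩)
  · obtain ⟨y, hy, rfl⟩ := ht.exists_of_mem_apply hM hκ ((mem_coe ⟨z, hM _ _ (j A).2 hz⟩ _).1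
      ((transfer j (fun _ _ a t _ _ => Sub a t) A t t t).1 hsub _ ((mem_coe _ _).2 hz)))
    rw [ht.apply_eq hV hM hκ htr hy]
    exact (mem_iff j _ _).2 hz
  · have h := (mem_iff j _ _).1 hz
    rwa [ht.apply_eq hV hM hκ htr (hsub z hz)] at h

/-- Smallness is carried through the induction because it is what makes j fix the lower levels
pointwise. -/
theorem IsCritPoint.exists_isVLevel_isSmall (hV : ModelsZFCMinusDC V) (hM : IsTransSub M)
    (hκ : IsCritPoint j κ) {δ : V} (hδ : δ ∈ₛ κ) : ∃ v : V, IsVLevel δ v ∧ IsSmall κ v := by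
  by_contra hn
  obtain ⟨δ, ⟨hδ, hns⟩, hmin⟩ := hV.foundation _ (isClass_of_uDef
    (fun _ _ δ κ _ _ _ => δ ∈ₛ κ ∧ ¬ ∃ v, IsVLevel δ v ∧ IsSmall κ v) κ κ κ κ) ⟨δ, hδ, hn⟩
  have hIH : ∀ β, β ∈ₛ δ → ∃ v, IsVLevel β v ∧ IsSmall κ v := fun β hβ =>
    not_not.1 fun h => hmin β hβ ⟨hκ.1.1 δ hδ β hβ, h⟩
  have hne : ∃ y, InVLevel δ y := by
    by_contra hemp
    obtain ⟨e, he⟩ := hV.empty_set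
    exact hns ⟨e, fun x => ⟨fun h => absurd h (he x), fun h => absurd ⟨x, h⟩ hemp⟩,
      δ, hδ, e, fun z hz => absurd hz (he z)⟩
  obtain ⟨f, hf, hS, hinj⟩ := hV.exists_injective (hκ.isCard hV.toModelsZFMinus hM)
    (isClass_of_uDef (fun _ _ x δ _ _ _ => InVLevel δ x) δ δ δ δ) hne fun α s hα hs hsS => by
      -- A sequence of length α < κ that cannot be extended exhausts `V_δ`, so its range witnesses
      -- that `V_δ` is a small set.
      by_contra hz
      obtain ⟨v, hv, hcov⟩ := hV.exists_range hs
      refine hns ⟨v, fun x => (hv x).trans ⟨fun ⟨β, hβ, hx⟩ => hsS β x hβ hx, fun hx => ?_⟩,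
        α, hα, s, hcov⟩
      obtain ⟨β, hβ⟩ := not_not.1 fun h => hz ⟨x, hx, h⟩
      exact ⟨β, hs.mem_of_pairMem hV.toModelsZFMinus hβ, hβ⟩
  obtain ⟨k, A, -, hk, hA, hmoved⟩ := hκ.exists_moved hV.toModelsZFMinus hM hf hinj
  have hcov : ∀ α x, α ∈ₛ κ → PairMem f α x → ∃ β, β ∈ₛ δ ∧ ∃ y, IsVLevel β y ∧ Sub x y :=
    fun α x hα hx => by
      obtain ⟨β, hβ, hxβ⟩ := hS α x hα hx
      obtain ⟨y, hy, -⟩ := hIH β hβ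
      refine ⟨β, hβ, y, hy, fun z hz => (hy z).2 ?_⟩
      exact hxβ.exists_mem hz
  obtain ⟨β, hβ, y, hy, hAy⟩ := (transfer j (fun W _ f κ δ _ => ∀ α x : W, α ∈ₛ κ → PairMem f α x →
    ∃ β, β ∈ₛ δ ∧ ∃ y, IsVLevel β y ∧ Sub x y) f κ δ δ).1 hcov k A hk hA
  have hβδ : (β : V) ∈ₛ δ := by
    have := (mem_coe _ _).1 hβ
    rwa [hκ.2.2 δ hδ] at this
  have hjβ : j (β : V) = β := Subtype.ext (hκ.2.2 _ (hκ.1.1 δ hδ _ hβδ))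
  obtain ⟨w, hw, hws⟩ := hIH β hβδ
  -- Since j(β) = β, j(w) is the level `V_β` of M, which is y; hence A ⊆ j(w).
  have hjw := (transfer j (fun _ _ β w _ _ => IsVLevel β w) (β : V) w w w).1 hw
  rw [hjβ] at hjw
  refine hmoved (hws.apply_eq_of_sub hV.toModelsZFMinus hM hκ ?_ fun z hz =>
    (hjw z).2 ((hy z).1 (hAy z hz)))
  exact fun x hx z hz => (hw z).2
    (((hw x).1 hx).of_mem (hκ.1.of_mem (hκ.1.1 δ hδ _ hβδ)) hz)

end

end SetModel

theorem mainTheorem6 {V : Type u} [SetModel.LSet.Structure V]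
    (hV : SetModel.ModelsZFCMinusDC V)
    (M : SetModel.LSet.Substructure V) (hM : SetModel.IsTransSub M)
    (j : FirstOrder.Language.ElementaryEmbedding SetModel.LSet V M)
    (hj : SetModel.IsNontrivial j)
    (κ : V) (hκ : SetModel.IsCritPoint j κ) :
    ∀ α : V, (α ∈ₛ κ ∨ α = κ) → SetModel.ClassIsSet (fun x : V => SetModel.InVLevel α x) := by
  have hlt : ∀ β, β ∈ₛ κ → ∃ v, SetModel.IsVLevel β v := fun β hβ =>
    (hκ.exists_isVLevel_isSmall hV hM hβ).imp fun _ h => h.1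
  rintro α (hα | rfl)
  · exact hlt α hα
  · exact hV.exists_isVLevel_of_cofinal hκ.1 (fun β hβ => hκ.exists_isSucc hV.toModelsZFMinus hM hβ)
      hlt
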